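/- Let $A\in\mathbb R^{n\times n}$, $B\in\mathbb R^{n\times p}$, $C\in\mathbb R^{q\times n}$, and suppose the linear system $\dot x=Ax+Bu$, $y=Cx$ is semistable, i.e. for $u\equiv 0$ the limit $\lim_{t\to\infty}x(t)$ exists for every initial state $x(0)\in\mathbb R^n$. Then $\mathcal J:=\lim_{\tau\to\infty}e^{A\tau}$ exists, $sI-A$ is invertible whenever $\operatorname{Re}s>0$, and the integrals defining the pseudo Gramians $$\mathcal P=\int_0^\infty (e^{A\tau}-\mathcal J)BB^\top(e^{A^\top\tau}-\mathcal J^\top)\,d\tau,\qquad \mathcal Q=\int_0^\infty (e^{A^\top\tau}-\mathcal J^\top)C^\top C(e^{A\tau}-\mathcal J)\,d\tau$$ converge absolutely. Put $\eta(s)=C(sI-A)^{-1}B$. Let $\mathcal H_2$ and $\mathcal H_\infty$ be the Hardy spaces of matrix-valued functions $F$ that are holomorphic on the open right half-plane and have finite norm $$\|F\|_{\mathcal H_2}=\Big(\sup_{\sigma>0}\frac1{2\pi}\int_{-\infty}^\infty \mathrm{tr}\big(F(\sigma+i\omega)^*F(\sigma+i\omega)\big)\,d\omega\Big)^{1/2},\qquad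 \|F\|_{\mathcal H_\infty}=\sup_{\operatorname{Re}s>0}\sigma_{\max}(F(s)),$$ respectively, where $\sigma_{\max}$ is the largest singular value. Then $$\eta\in\mathcal H_2\iff C\mathcal JB=0,\qquad \eta\in\mathcal H_\infty\iff C\mathcal JB=0.$$ Moreover, if $C\mathcal JB=0$, then $$\|\eta\|_{\mathcal H_2}^2=\mathrm{tr}(C\mathcal PC^\top)=\mathrm{tr}(B^\top\mathcal QB),$$ and, for every $\gamma>0$, $\|\eta\|_{\mathcal H_\infty}\le\gamma$ if there exists a symmetric positive semidefinite $\mathcal K\in\mathbb R^{n\times n}$ with $$\begin{bmatrix}A^\top\mathcal K+\mathcal KA & \mathcal KB & (I-\mathcal J)^\top C^\top\\ B^\top\mathcal K & -\gamma I & 0\\ C(I-\mathcal J) & 0 & -\gamma I\end{bmatrix}\preceq 0,\qquad \mathcal J^\top\mathcal K\mathcal J=0 .$$ -/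

import Mathlib

open Filter Topology MeasureTheory
open scoped ENNReal Matrix

/-- A linear time-invariant system `x' = A x + B u`, `y = C x` with state space `ℝⁿ`,
input space `ℝᵖ` and output space `ℝ^q`. -/
structure LTISystem (n p q : ℕ) where
  A : Matrix (Fin n) (Fin n) ℝ
  B : Matrix (Fin n) (Fin p) ℝ
  C : Matrix (Fin q) (Fin n) ℝ

/-- The open right half-plane. -/
def openRightHalfPlane : Set ℂ := {s | 0 < s.re}

section Hardy

variable {q p : ℕ}

/-- Holomorphy on the open right half-plane of a matrix-valued function, entry by entry. -/
def IsHolomorphicOnRHP (F : ℂ → Matrix (Fin q) (Fin p) ℂ) : Prop :=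
  ∀ i j, DifferentiableOn ℂ (fun s => F s i j) openRightHalfPlane

/-- The `H₂` norm on the open right half-plane, with values in `[0, ∞]`:
`‖F‖² = sup_{σ > 0} (1 / 2π) ∫ tr (F(σ + iω)ᴴ F(σ + iω)) dω`.
The integrand is the sum of the squared absolute values of the entries. -/
noncomputable def hTwoNorm (F : ℂ → Matrix (Fin q) (Fin p) ℂ) : ℝ≥0∞ :=
  (⨆ (σ : ℝ) (_ : 0 < σ), ENNReal.ofReal (1 / (2 * Real.pi)) *
    ∫⁻ ω : ℝ, ∑ i, ∑ j, ‖F ((σ : ℂ) + (ω : ℂ) * Complex.I) i j‖ₑ ^ 2) ^ (1 / 2 : ℝ)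

/-- The Hardy space `H₂` of matrix-valued functions on the open right half-plane. -/
def MemHTwo (F : ℂ → Matrix (Fin q) (Fin p) ℂ) : Prop :=
  IsHolomorphicOnRHP F ∧ hTwoNorm F < ∞

open scoped Matrix.Norms.L2Operator in
/-- The spectral norm (largest singular value) of a complex matrix: its operator norm with
respect to the Euclidean norms. -/
noncomputable def spectralNorm₂ (M : Matrix (Fin q) (Fin p) ℂ) : ℝ := ‖M‖

/-- The `H∞` norm on the open right half-plane, with values in `[0, ∞]`:
the supremum over `Re s > 0` of the largest singular value of `F s`. -/
noncomputable def hInfNorm (F : ℂ → Matrix (Fin q) (Fin p) ℂ) : ℝ≥0∞ :=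
  ⨆ s ∈ openRightHalfPlane, ENNReal.ofReal (spectralNorm₂ (F s))

/-- The Hardy space `H∞` of matrix-valued functions on the open right half-plane. -/
def MemHInf (F : ℂ → Matrix (Fin q) (Fin p) ℂ) : Prop :=
  IsHolomorphicOnRHP F ∧ hInfNorm F < ∞

end Hardy

namespace LTISystem

variable {n p q : ℕ} (S : LTISystem n p q)

/-- `x` is a state trajectory on `[0, ∞)` for the input `u`: `x' = A x + B u`
(with the one-sided derivative at `t = 0`). -/
def IsTrajectory (u : ℝ → Fin p → ℝ) (x : ℝ → Fin n → ℝ) : Prop :=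
  ∀ t : ℝ, 0 ≤ t → HasDerivWithinAt x (S.A *ᵥ x t + S.B *ᵥ u t) (Set.Ici 0) t

/-- Semistability: for zero input and every initial state `x 0`, the limit of `x t` as `t → ∞`
exists. -/
def IsSemistable : Prop :=
  ∀ x : ℝ → Fin n → ℝ, S.IsTrajectory (fun _ => 0) x →
    ∃ l : Fin n → ℝ, Tendsto x atTop (𝓝 l)

/-- The limit matrix `J = lim_{τ → ∞} e^{Aτ}`. -/
noncomputable def J : Matrix (Fin n) (Fin n) ℝ :=
  limUnder atTop (fun τ : ℝ => NormedSpace.exp (τ • S.A))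

/-- The transfer function `η(s) = C (sI - A)⁻¹ B`. -/
noncomputable def transferFunction (s : ℂ) : Matrix (Fin q) (Fin p) ℂ :=
  S.C.map Complex.ofReal * (s • (1 : Matrix (Fin n) (Fin n) ℂ) - S.A.map Complex.ofReal)⁻¹ *
    S.B.map Complex.ofReal

/-- The integrand `(e^{Aτ} - J) B Bᵀ (e^{Aᵀτ} - Jᵀ)`. -/
noncomputable def gramIntegrandP (τ : ℝ) : Matrix (Fin n) (Fin n) ℝ :=
  (NormedSpace.exp (τ • S.A) - S.J) * S.B * S.Bᵀ * (NormedSpace.exp (τ • S.Aᵀ) - S.Jᵀ)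

/-- The integrand `(e^{Aᵀτ} - Jᵀ) Cᵀ C (e^{Aτ} - J)`. -/
noncomputable def gramIntegrandQ (τ : ℝ) : Matrix (Fin n) (Fin n) ℝ :=
  (NormedSpace.exp (τ • S.Aᵀ) - S.Jᵀ) * S.Cᵀ * S.C * (NormedSpace.exp (τ • S.A) - S.J)

/-- The pseudo controllability Gramian (the integral is taken entry by entry). -/
noncomputable def gramP : Matrix (Fin n) (Fin n) ℝ :=
  Matrix.of fun i j => ∫ τ in Set.Ioi (0 : ℝ), S.gramIntegrandP τ i j

/-- The pseudo observability Gramian (the integral is taken entry by entry). -/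
noncomputable def gramQ : Matrix (Fin n) (Fin n) ℝ :=
  Matrix.of fun i j => ∫ τ in Set.Ioi (0 : ℝ), S.gramIntegrandQ τ i j

/-- The symmetric block matrix
`[[Aᵀ K + K A, (Bᵀ K)ᵀ, (C (I - J))ᵀ], [Bᵀ K, -γ I, 0], [C (I - J), 0, -γ I]]`. -/
noncomputable def lmiMatrix (γ : ℝ) (K : Matrix (Fin n) (Fin n) ℝ) :
    Matrix ((Fin n ⊕ Fin p) ⊕ Fin q) ((Fin n ⊕ Fin p) ⊕ Fin q) ℝ :=
  Matrix.fromBlocks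
    (Matrix.fromBlocks (S.Aᵀ * K + K * S.A) (S.Bᵀ * K)ᵀ (S.Bᵀ * K) (-(γ • 1)))
    (Matrix.fromRows (S.C * (1 - S.J))ᵀ 0)
    (Matrix.fromCols (S.C * (1 - S.J)) 0)
    (-(γ • 1))

end LTISystem

/-!
Write `N(t) = e^{tA} - J`. Semistability says that `e^{tA}` converges, and then `J` is an
idempotent with `A J = J A = 0` that absorbs `e^{tA}`, so `N(s + t) = N(s) N(t)`. Since `N` tends
to `0`, the semigroup law makes it decay exponentially
(`LTISystem.IsSemistable.exists_norm_transient_le`). This gives the integrability of the pseudo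
Gramian integrands and, on `Re s > 0`, the formula `(sI - A)⁻¹ = J / s + ∫₀^∞ e^{-st} N(t) dt`
(`LTISystem.IsSemistable.resolvent_eq`).

Consequently `η(s) = CJB / s + ĥ(s)`, where `ĥ` is the Laplace transform of `h(t) = C N(t) B` and is
bounded on `Re s > 0` (`LTISystem.IsSemistable.transferFunction_apply`). If `CJB ≠ 0`, the pole at
the origin makes both Hardy norms infinite. If `CJB = 0`, then `η = ĥ` is bounded. By Plancherel's
theorem (`lintegral_enorm_sq_laplace`) the squared `L²` norm of `ĥ` on the line `Re s = σ`, divided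
by `2π`, is `∫₀^∞ e^{-2σt} ‖h(t)‖² dt` in the Frobenius norm, and the supremum over `σ > 0` is
`∫₀^∞ ‖h(t)‖² dt`. Both traces with the pseudo Gramians equal this integral, because
`‖h‖² = tr (h hᵀ) = tr (hᵀ h)`.

For the `H∞` bound, put `x = (sI - A)⁻¹ B u` and `y = C x = η(s) u`. As `C J x = 0`, testing the
linear matrix inequality on the real and imaginary parts of `(x, u, y / γ)` yields
`2 Re(s) x* K x + ‖y‖² / γ ≤ γ ‖u‖²`, hence `‖y‖ ≤ γ ‖u‖`
(`LTISystem.IsSemistable.norm_output_le`).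
-/

/-! ### Plancherel's theorem for the Laplace transform -/

open scoped FourierTransform SchwartzMap ContDiff in
/-- Plancherel's theorem for the integral Fourier transform on `L¹ ∩ L²`. The `L²` Fourier
transform of `f` is known to be an isometry and to agree with `𝓕 f` as a tempered distribution, so
the two coincide almost everywhere. -/
theorem lintegral_enorm_sq_fourier_eq {f : ℝ → ℂ} (h1 : Integrable f) (h2 : MemLp f 2) :
    ∫⁻ ξ, ‖𝓕 f ξ‖ₑ ^ 2 = ∫⁻ t, ‖f t‖ₑ ^ 2 := by
  have key : ∀ᵐ ξ, (𝓕 (h2.toLp f) : Lp ℂ 2 (volume : Measure ℝ)) ξ = 𝓕 f ξ := by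
    apply ae_eq_of_integral_contDiff_smul_eq
    · exact (Lp.memLp _).locallyIntegrable (by norm_num)
    · exact (VectorFourier.fourierIntegral_continuous Real.continuous_fourierChar
        (by exact continuous_inner) h1).locallyIntegrable
    · intro g g_smooth g_cpt
      have hg₁ : HasCompactSupport (Complex.ofRealCLM ∘ g) := g_cpt.comp_left rfl
      have hg₂ : ContDiff ℝ ∞ (Complex.ofRealCLM ∘ g) := by fun_prop
      set G : 𝓢(ℝ, ℂ) := hg₁.toSchwartzMap hg₂
      have e1 : ∀ x, G x = (g x : ℂ) := fun x => rfl
      have e2 := congrArg (fun T : 𝓢'(ℝ, ℂ) => T G)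
        (Lp.fourier_toTemperedDistribution_eq (h2.toLp f))
      simp only [TemperedDistribution.fourier_apply, Lp.toTemperedDistribution_apply] at e2
      have e3 := VectorFourier.integral_fourierIntegral_smul_eq_flip (L := innerₗ ℝ)
        Real.continuous_fourierChar (by exact continuous_inner) (G.integrable (μ := volume)) h1
      calc ∫ x, g x • (𝓕 (h2.toLp f) : Lp ℂ 2 (volume : Measure ℝ)) x
          = ∫ x, (𝓕 G) x • (h2.toLp f) x := by
            rw [e2]; simp [e1]
        _ = ∫ x, (𝓕 G) x • f x := by
            apply integral_congr_ae
            filter_upwards [h2.coeFn_toLp] with x hx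
            rw [hx]
        _ = ∫ x, G x • 𝓕 f x := by
            rw [flip_innerₗ] at e3
            exact e3
        _ = _ := by simp [e1]
  have hn : eLpNorm (𝓕 f) 2 volume = eLpNorm f 2 volume := by
    rw [← eLpNorm_congr_ae key, ← eLpNorm_congr_ae h2.coeFn_toLp, ← Lp.enorm_def, ← Lp.enorm_def,
      enorm_eq_iff_norm_eq, Lp.norm_fourier_eq]
  rw [eLpNorm_eq_lintegral_rpow_enorm_toReal (by norm_num) (by norm_num),
    eLpNorm_eq_lintegral_rpow_enorm_toReal (by norm_num) (by norm_num)] at hn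
  simpa using ENNReal.rpow_left_injective (x := 1 / 2) (by norm_num) (by simpa using hn)

theorem lintegral_comp_div_const (f : ℝ → ℝ≥0∞) {c : ℝ} (hc : 0 < c) :
    ∫⁻ x, f (x / c) = ENNReal.ofReal c * ∫⁻ x, f x := by
  have h := Real.map_volume_mul_left (a := c⁻¹) (by positivity)
  rw [inv_inv, abs_of_pos hc] at h
  have he : MeasurableEmbedding (fun x : ℝ => c⁻¹ * x) :=
    (Homeomorph.mulLeft₀ c⁻¹ (by positivity)).measurableEmbedding
  rw [← smul_eq_mul, ← lintegral_smul_measure, ← h, he.lintegral_map]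
  simp [div_eq_inv_mul]

/-- The Laplace transform of a function on `(0, ∞)`; it is `0` where the integral diverges. -/
noncomputable def laplace (h : ℝ → ℂ) (s : ℂ) : ℂ :=
  ∫ t in Set.Ioi (0 : ℝ), Complex.exp (-s * t) * h t

open scoped FourierTransform in
/-- Plancherel's theorem on the vertical line `Re s = σ`: the Laplace transform at `σ + iω` is the
Fourier transform of `1_{t > 0} e^{-σt} h(t)` at the frequency `ω / 2π`. -/
theorem lintegral_enorm_sq_laplace {h : ℝ → ℂ} (σ : ℝ)
    (h1 : IntegrableOn (fun t : ℝ => Complex.exp (-σ * t) * h t) (Set.Ioi 0))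
    (h2 : MemLp (fun t : ℝ => Complex.exp (-σ * t) * h t) 2 (volume.restrict (Set.Ioi 0))) :
    ∫⁻ ω : ℝ, ‖laplace h (σ + ω * Complex.I)‖ₑ ^ 2 =
      ENNReal.ofReal (2 * Real.pi) *
        ∫⁻ t in Set.Ioi (0 : ℝ), ‖Complex.exp (-σ * t) * h t‖ₑ ^ 2 := by
  set g : ℝ → ℂ := (Set.Ioi (0 : ℝ)).indicator (fun t : ℝ => Complex.exp (-σ * t) * h t) with hg
  have hF : ∀ ω : ℝ, laplace h (σ + ω * Complex.I) = 𝓕 g (ω / (2 * Real.pi)) := by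
    intro ω
    rw [Real.fourier_real_eq_integral_exp_smul, laplace, ← integral_indicator measurableSet_Ioi]
    refine integral_congr_ae (ae_of_all _ fun t => ?_)
    by_cases ht : t ∈ Set.Ioi (0 : ℝ)
    · simp only [hg, Set.indicator_of_mem ht, smul_eq_mul]
      rw [← mul_assoc, ← Complex.exp_add]
      congr 2
      have : (Real.pi : ℂ) ≠ 0 := by exact_mod_cast Real.pi_ne_zero
      push_cast
      field_simp
      ring
    · simp [hg, Set.indicator_of_notMem ht]
  simp_rw [hF]
  rw [lintegral_comp_div_const (fun x => ‖𝓕 g x‖ₑ ^ 2) Real.two_pi_pos,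
    lintegral_enorm_sq_fourier_eq ((integrable_indicator_iff measurableSet_Ioi).2 h1)
      ((memLp_indicator_iff_restrict measurableSet_Ioi).2 h2),
    ← lintegral_indicator measurableSet_Ioi]
  congr 2 with t
  by_cases ht : t ∈ Set.Ioi (0 : ℝ)
  · simp [Set.indicator_of_mem ht]
  · simp [Set.indicator_of_notMem ht]

/-! ### The matrix exponential of a semistable system -/

section MatrixExponential

variable {n : ℕ}

open scoped Matrix.Norms.L2Operator in
theorem hasDerivAt_exp_apply (A : Matrix (Fin n) (Fin n) ℝ) (t : ℝ) (i j : Fin n) :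
    HasDerivAt (fun t : ℝ => NormedSpace.exp (t • A) i j)
      ((A * NormedSpace.exp (t • A)) i j) t :=
  (LinearMap.toContinuousLinearMap (Matrix.entryLinearMap ℝ ℝ i j)).hasFDerivAt.comp_hasDerivAt t
    (hasDerivAt_exp_smul_const' A t)

theorem continuous_exp_smul (A : Matrix (Fin n) (Fin n) ℝ) :
    Continuous (fun t : ℝ => NormedSpace.exp (t • A)) :=
  continuous_matrix fun i j => continuous_iff_continuousAt.2 fun t =>
    (hasDerivAt_exp_apply A t i j).continuousAt

theorem exp_add_smul (A : Matrix (Fin n) (Fin n) ℝ) (s t : ℝ) :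
    NormedSpace.exp ((s + t) • A) = NormedSpace.exp (s • A) * NormedSpace.exp (t • A) := by
  rw [add_smul, Matrix.exp_add_of_commute]
  exact ((Commute.refl A).smul_left s).smul_right t

end MatrixExponential

namespace LTISystem

variable {n p q : ℕ} (S : LTISystem n p q)

/-- The transient part `e^{tA} - J` of the matrix exponential. -/
noncomputable def transient (t : ℝ) : Matrix (Fin n) (Fin n) ℝ :=
  NormedSpace.exp (t • S.A) - S.J

theorem isTrajectory_exp (v : Fin n → ℝ) :
    S.IsTrajectory (fun _ => 0) (fun t => NormedSpace.exp (t • S.A) *ᵥ v) := by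
  intro t _
  rw [Matrix.mulVec_zero, add_zero, Matrix.mulVec_mulVec]
  refine (hasDerivAt_pi.2 fun i => ?_).hasDerivWithinAt
  simp only [Matrix.mulVec, dotProduct]
  exact HasDerivAt.fun_sum fun j _ => (hasDerivAt_exp_apply S.A t i j).mul_const (v j)

variable {S} (hS : S.IsSemistable)
include hS

/-- The columns of `e^{tA}` are trajectories, so they converge by semistability. -/
theorem IsSemistable.tendsto_exp :
    Tendsto (fun τ : ℝ => NormedSpace.exp (τ • S.A)) atTop (𝓝 S.J) := by
  choose l hl using fun j : Fin n => hS _ (S.isTrajectory_exp (Pi.single j 1))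
  refine tendsto_nhds_limUnder ⟨Matrix.of fun i j => l j i, ?_⟩
  refine tendsto_pi_nhds.2 fun i => tendsto_pi_nhds.2 fun j => ?_
  simpa using tendsto_pi_nhds.1 (hl j) i

theorem IsSemistable.exp_mul_J (t : ℝ) : NormedSpace.exp (t • S.A) * S.J = S.J := by
  have h := hS.tendsto_exp
  refine tendsto_nhds_unique (h.const_mul (NormedSpace.exp (t • S.A))) ?_
  simp_rw [← exp_add_smul]
  exact h.comp (tendsto_atTop_add_const_left _ t tendsto_id)

theorem IsSemistable.J_mul_exp (t : ℝ) : S.J * NormedSpace.exp (t • S.A) = S.J := by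
  have h := hS.tendsto_exp
  refine tendsto_nhds_unique (h.mul_const (NormedSpace.exp (t • S.A))) ?_
  simp_rw [← exp_add_smul]
  exact h.comp (tendsto_atTop_add_const_right _ t tendsto_id)

theorem IsSemistable.J_mul_J : S.J * S.J = S.J :=
  tendsto_nhds_unique (hS.tendsto_exp.mul_const S.J)
    (by simp_rw [hS.exp_mul_J]; exact tendsto_const_nhds)

/-- `A J = 0`: it is the derivative at `0` of the constant function `e^{tA} J = J`. -/
theorem IsSemistable.A_mul_J : S.A * S.J = 0 := by
  ext i j
  have h : HasDerivAt (fun t : ℝ => (NormedSpace.exp (t • S.A) * S.J) i j)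
      ((S.A * NormedSpace.exp ((0 : ℝ) • S.A) * S.J) i j) 0 := by
    simp only [Matrix.mul_apply (N := S.J)]
    exact HasDerivAt.fun_sum fun k _ => (hasDerivAt_exp_apply S.A 0 i k).mul_const (S.J k j)
  simp_rw [hS.exp_mul_J, zero_smul, NormedSpace.exp_zero, mul_one] at h
  exact h.unique (hasDerivAt_const _ _)

/-- `J A = 0`: it is the derivative at `0` of the constant function `J e^{tA} = J`. -/
theorem IsSemistable.J_mul_A : S.J * S.A = 0 := by
  ext i j
  have h : HasDerivAt (fun t : ℝ => (S.J * NormedSpace.exp (t • S.A)) i j)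
      ((S.J * (S.A * NormedSpace.exp ((0 : ℝ) • S.A))) i j) 0 := by
    simp only [Matrix.mul_apply (M := S.J)]
    exact HasDerivAt.fun_sum fun k _ => (hasDerivAt_exp_apply S.A 0 k j).const_mul (S.J i k)
  simp_rw [hS.J_mul_exp, zero_smul, NormedSpace.exp_zero, mul_one] at h
  exact h.unique (hasDerivAt_const _ _)

/-- The transient part satisfies the semigroup law, which is what makes its decay exponential. -/
theorem IsSemistable.transient_add (s t : ℝ) :
    S.transient (s + t) = S.transient s * S.transient t := by
  simp only [transient, exp_add_smul, sub_mul, mul_sub, hS.exp_mul_J, hS.J_mul_exp, hS.J_mul_J]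
  abel

theorem IsSemistable.tendsto_transient : Tendsto S.transient atTop (𝓝 0) :=
  sub_self S.J ▸ hS.tendsto_exp.sub_const S.J

omit hS in
theorem continuous_transient : Continuous S.transient :=
  (continuous_exp_smul S.A).sub continuous_const

theorem IsSemistable.hasDerivAt_transient (t : ℝ) (i j : Fin n) :
    HasDerivAt (fun t => S.transient t i j) ((S.A * S.transient t) i j) t := by
  simpa [transient, mul_sub, hS.A_mul_J] using (hasDerivAt_exp_apply S.A t i j).sub_const (S.J i j)

open scoped Matrix.Norms.L2Operator in
/-- Exponential decay of the transient: it tends to `0`, so `‖transient T‖ ≤ e⁻¹` for some `T > 0`,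
and the semigroup law multiplies this gain over successive intervals of length `T`. -/
theorem IsSemistable.exists_norm_transient_le :
    ∃ M ε : ℝ, 0 < ε ∧ ∀ t, 0 ≤ t → ‖S.transient t‖ ≤ M * Real.exp (-ε * t) := by
  have h0 : Tendsto (fun t => ‖S.transient t‖) atTop (𝓝 0) := by
    simpa using hS.tendsto_transient.norm
  obtain ⟨T, hT, hT0⟩ :=
    ((h0.eventually_le_const (Real.exp_pos (-1))).and (eventually_gt_atTop 0)).exists
  obtain ⟨K, hK⟩ := (isCompact_Icc (a := (0 : ℝ)) (b := T)).exists_bound_of_continuousOn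
    S.continuous_transient.continuousOn
  have hK0 : 0 ≤ K := (norm_nonneg _).trans (hK 0 ⟨le_rfl, hT0.le⟩)
  -- On `[kT, (k + 1)T]` the norm is at most `K e^{-k}`, where `K` bounds it on `[0, T]`.
  have step : ∀ k : ℕ, ∀ r ∈ Set.Icc 0 T, ‖S.transient (k * T + r)‖ ≤ K * Real.exp (-k) := by
    intro k r hr
    induction k with
    | zero => simpa using hK r hr
    | succ k ih =>
      calc ‖S.transient ((k + 1 : ℕ) * T + r)‖
          = ‖S.transient T * S.transient (k * T + r)‖ := by
            rw [← hS.transient_add]; congr 2; push_cast; ring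
        _ ≤ Real.exp (-1) * (K * Real.exp (-k)) :=
            (norm_mul_le _ _).trans (mul_le_mul hT ih (norm_nonneg _) (Real.exp_pos _).le)
        _ = K * Real.exp (-(k + 1 : ℕ)) := by
            rw [mul_left_comm, ← Real.exp_add]; push_cast; ring_nf
  refine ⟨K * Real.exp 1, 1 / T, by positivity, fun t ht => ?_⟩
  have hfl : (⌊t / T⌋₊ : ℝ) * T ≤ t := (le_div_iff₀ hT0).1 (Nat.floor_le (by positivity))
  have hfu : t ≤ (⌊t / T⌋₊ + 1 : ℝ) * T := ((div_lt_iff₀ hT0).1 (Nat.lt_floor_add_one _)).le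
  calc ‖S.transient t‖ = ‖S.transient (⌊t / T⌋₊ * T + (t - ⌊t / T⌋₊ * T))‖ := by
        rw [add_sub_cancel]
    _ ≤ K * Real.exp (-⌊t / T⌋₊) := step _ _ ⟨by linarith, by linarith⟩
    _ ≤ K * Real.exp (1 + -(1 / T) * t) := by
        gcongr
        have : t / T ≤ ⌊t / T⌋₊ + 1 := (Nat.lt_floor_add_one _).le
        have : -(1 / T) * t = -(t / T) := by ring
        linarith
    _ = K * Real.exp 1 * Real.exp (-(1 / T) * t) := by rw [Real.exp_add, mul_assoc]

end LTISystem

/-! ### Exponentially decaying functions and their Laplace transforms -/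

/-- `h` is continuous and decays exponentially at `+∞`. -/
def ExpDecay (h : ℝ → ℝ) : Prop :=
  Continuous h ∧ ∃ M ε : ℝ, 0 < ε ∧ ∀ t, 0 ≤ t → |h t| ≤ M * Real.exp (-ε * t)

open scoped Matrix.Norms.L2Operator in
theorem LTISystem.IsSemistable.expDecay_transient_apply {n p q : ℕ} {S : LTISystem n p q}
    (hS : S.IsSemistable) (i j : Fin n) : ExpDecay (fun t => S.transient t i j) := by
  refine ⟨S.continuous_transient.matrix_elem i j, ?_⟩
  obtain ⟨M, ε, hε, hM⟩ := hS.exists_norm_transient_le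
  set L := LinearMap.toContinuousLinearMap (Matrix.entryLinearMap (m := Fin n) (n := Fin n) ℝ ℝ i j)
  refine ⟨‖L‖ * M, ε, hε, fun t ht => (L.le_opNorm (S.transient t)).trans ?_⟩
  rw [mul_assoc]
  exact mul_le_mul_of_nonneg_left (hM t ht) (norm_nonneg _)

namespace ExpDecay

theorem zero : ExpDecay (fun _ => 0) := ⟨continuous_const, 0, 1, one_pos, by simp⟩

theorem const_mul {h : ℝ → ℝ} (hh : ExpDecay h) (c : ℝ) : ExpDecay (fun t => c * h t) := by
  obtain ⟨hc, M, ε, hε, hM⟩ := hh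
  refine ⟨continuous_const.mul hc, |c| * M, ε, hε, fun t ht => ?_⟩
  rw [abs_mul, mul_assoc]
  exact mul_le_mul_of_nonneg_left (hM t ht) (abs_nonneg c)

theorem nonneg_bound {h : ℝ → ℝ} {M ε : ℝ} (hM : ∀ t, 0 ≤ t → |h t| ≤ M * Real.exp (-ε * t)) :
    0 ≤ M := by
  simpa using (abs_nonneg _).trans (hM 0 le_rfl)

theorem add {f g : ℝ → ℝ} (hf : ExpDecay f) (hg : ExpDecay g) :
    ExpDecay (fun t => f t + g t) := by
  obtain ⟨hc, M, ε, hε, hM⟩ := hf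
  obtain ⟨hc', M', ε', hε', hM'⟩ := hg
  refine ⟨hc.add hc', M + M', min ε ε', lt_min hε hε', fun t ht => ?_⟩
  have h1 := nonneg_bound hM
  have h2 := nonneg_bound hM'
  calc |f t + g t| ≤ M * Real.exp (-ε * t) + M' * Real.exp (-ε' * t) :=
        (abs_add_le _ _).trans (add_le_add (hM t ht) (hM' t ht))
    _ ≤ M * Real.exp (-min ε ε' * t) + M' * Real.exp (-min ε ε' * t) := by
        gcongr
        · exact min_le_left _ _
        · exact min_le_right _ _
    _ = _ := by ring

theorem sum {ι : Type*} (s : Finset ι) {f : ι → ℝ → ℝ} (hf : ∀ i ∈ s, ExpDecay (f i)) :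
    ExpDecay (fun t => ∑ i ∈ s, f i t) := by
  induction s using Finset.cons_induction with
  | empty => simpa using zero
  | cons a s ha ih =>
    simp only [Finset.sum_cons]
    exact (hf a (by simp)).add (ih fun i hi => hf i (by simp [hi]))

theorem mul {f g : ℝ → ℝ} (hf : ExpDecay f) (hg : ExpDecay g) :
    ExpDecay (fun t => f t * g t) := by
  obtain ⟨hc, M, ε, hε, hM⟩ := hf
  obtain ⟨hc', M', ε', hε', hM'⟩ := hg
  have h1 := nonneg_bound hM
  refine ⟨hc.mul hc', M * M', ε + ε', by positivity, fun t ht => ?_⟩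
  calc |f t * g t| ≤ (M * Real.exp (-ε * t)) * (M' * Real.exp (-ε' * t)) := by
        rw [abs_mul]
        exact mul_le_mul (hM t ht) (hM' t ht) (abs_nonneg _) (by positivity)
    _ = M * M' * Real.exp (-(ε + ε') * t) := by
        rw [mul_mul_mul_comm, ← Real.exp_add]; ring_nf

variable {h : ℝ → ℝ} (hh : ExpDecay h)
include hh

theorem integrableOn : IntegrableOn h (Set.Ioi 0) := by
  obtain ⟨hc, M, ε, hε, hM⟩ := hh
  refine ((exp_neg_integrableOn_Ioi 0 hε).const_mul M).mono' hc.aestronglyMeasurable ?_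
  exact (ae_restrict_iff' measurableSet_Ioi).2 (ae_of_all _ fun t ht => hM t (le_of_lt ht))

omit hh in
theorem norm_exp_mul_le {s : ℂ} (hs : 0 ≤ s.re) {t : ℝ} (ht : 0 ≤ t) :
    ‖Complex.exp (-s * t) * h t‖ ≤ |h t| := by
  rw [norm_mul, Complex.norm_exp, Complex.norm_real, Real.norm_eq_abs]
  refine mul_le_of_le_one_left (abs_nonneg _) (Real.exp_le_one_iff.2 ?_)
  simpa using mul_nonneg hs ht

theorem integrableOn_exp_mul {s : ℂ} (hs : 0 ≤ s.re) :
    IntegrableOn (fun t : ℝ => Complex.exp (-s * t) * h t) (Set.Ioi 0) := by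
  have hc := hh.1
  refine (Integrable.abs hh.integrableOn).mono' ?_ ?_
  · exact Continuous.aestronglyMeasurable (by fun_prop)
  · exact (ae_restrict_iff' measurableSet_Ioi).2
      (ae_of_all _ fun t ht => norm_exp_mul_le hs (le_of_lt ht))

theorem memLp_exp_mul {s : ℂ} (hs : 0 ≤ s.re) :
    MemLp (fun t : ℝ => Complex.exp (-s * t) * h t) 2 (volume.restrict (Set.Ioi 0)) := by
  have hc := hh.1
  have hm : AEStronglyMeasurable (fun t : ℝ => Complex.exp (-s * t) * h t)
      (volume.restrict (Set.Ioi 0)) := Continuous.aestronglyMeasurable (by fun_prop)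
  rw [memLp_two_iff_integrable_sq_norm hm]
  refine (hh.mul hh).integrableOn.mono' (by fun_prop) ?_
  refine (ae_restrict_iff' measurableSet_Ioi).2 (ae_of_all _ fun t ht => ?_)
  rw [norm_pow, norm_norm, ← abs_mul_abs_self, ← sq]
  exact pow_le_pow_left₀ (norm_nonneg _) (norm_exp_mul_le hs (le_of_lt ht)) 2

theorem norm_laplace_le {s : ℂ} (hs : 0 ≤ s.re) :
    ‖laplace (fun t => h t) s‖ ≤ ∫ t in Set.Ioi (0 : ℝ), |h t| :=
  norm_integral_le_of_norm_le (Integrable.abs hh.integrableOn)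
    ((ae_restrict_iff' measurableSet_Ioi).2
      (ae_of_all _ fun _ ht => norm_exp_mul_le hs (le_of_lt ht)))

theorem tendsto_atTop : Tendsto h atTop (𝓝 0) := by
  obtain ⟨hc, M, ε, hε, hM⟩ := hh
  refine squeeze_zero_norm' ((eventually_ge_atTop 0).mono hM) ?_
  simpa using (Real.tendsto_exp_atBot.comp
    (tendsto_id.const_mul_atTop_of_neg (neg_neg_of_pos hε))).const_mul M

/-- The Laplace transform of a derivative. -/
theorem laplace_deriv {h' : ℝ → ℝ} (hh' : ExpDecay h') (hd : ∀ t, HasDerivAt h (h' t) t)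
    {s : ℂ} (hs : 0 ≤ s.re) :
    laplace (fun t => h' t) s = s * laplace (fun t => h t) s - h 0 := by
  have hd2 : ∀ t : ℝ, HasDerivAt (fun t : ℝ => Complex.exp (-s * t) * h t)
      (Complex.exp (-s * t) * h' t - s * (Complex.exp (-s * t) * h t)) t := by
    intro t
    have h1 : HasDerivAt (fun t : ℝ => Complex.exp (-s * t)) (Complex.exp (-s * t) * (-s * 1)) t :=
      ((Complex.ofRealCLM.hasDerivAt (x := t)).const_mul (-s)).cexp
    exact (h1.mul (hd t).ofReal_comp).congr_deriv (by ring)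
  have hlim : Tendsto (fun t : ℝ => Complex.exp (-s * t) * h t) atTop (𝓝 0) := by
    refine squeeze_zero_norm' ((eventually_ge_atTop 0).mono fun t ht => norm_exp_mul_le hs ht) ?_
    simpa using hh.tendsto_atTop.abs
  have i1 := hh'.integrableOn_exp_mul hs
  have i2 := (hh.integrableOn_exp_mul hs).const_mul s
  have := integral_Ioi_of_hasDerivAt_of_tendsto (hd2 0).continuousAt.continuousWithinAt
    (fun t _ => hd2 t) (i1.sub i2) hlim
  rw [integral_sub i1 i2, integral_const_mul] at this
  simp only [laplace]
  simp only [Complex.ofReal_zero, mul_zero, Complex.exp_zero, one_mul, zero_sub] at this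
  linear_combination this

omit hh in
theorem laplace_const_mul (c : ℝ) (s : ℂ) :
    laplace (fun t => (c * h t : ℝ)) s = c * laplace (fun t => h t) s := by
  rw [laplace, laplace, ← integral_const_mul]
  congr with t
  push_cast
  ring

omit hh in
theorem laplace_sum {ι : Type*} (J : Finset ι) {f : ι → ℝ → ℝ} (hf : ∀ i ∈ J, ExpDecay (f i))
    {s : ℂ} (hs : 0 ≤ s.re) :
    laplace (fun t => (∑ i ∈ J, f i t : ℝ)) s = ∑ i ∈ J, laplace (fun t => f i t) s := by
  simp only [laplace]
  rw [← integral_finsetSum _ fun i hi => (hf i hi).integrableOn_exp_mul hs]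
  congr with t
  push_cast
  rw [Finset.mul_sum]

end ExpDecay

/-! ### The resolvent and the pseudo Gramians -/

theorem ExpDecay.matrix_mul_apply {a b c : ℕ} {F : ℝ → Matrix (Fin a) (Fin b) ℝ}
    {G : ℝ → Matrix (Fin b) (Fin c) ℝ} (hF : ∀ i j, ExpDecay (fun t => F t i j))
    (hG : ∀ i j, ExpDecay (fun t => G t i j)) (i : Fin a) (j : Fin c) :
    ExpDecay (fun t => (F t * G t) i j) := by
  simp only [Matrix.mul_apply]
  exact ExpDecay.sum _ fun k _ => (hF i k).mul (hG k j)

/-- The trace of `C (∫ X) D` is the integral of the traces of `C X D`. -/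
theorem trace_mul_integral_mul {n a : ℕ} {X : ℝ → Matrix (Fin n) (Fin n) ℝ} {μ : Measure ℝ}
    (hX : ∀ i j, Integrable (fun t => X t i j) μ) (C : Matrix (Fin a) (Fin n) ℝ)
    (D : Matrix (Fin n) (Fin a) ℝ) :
    (C * Matrix.of (fun i j => ∫ t, X t i j ∂μ) * D).trace = ∫ t, (C * X t * D).trace ∂μ := by
  simp only [Matrix.trace, Matrix.diag, Matrix.mul_apply, Matrix.of_apply]
  have h1 : ∀ i k l, Integrable (fun t => C i l * X t l k) μ := fun i k l => (hX l k).const_mul _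
  have h2 : ∀ i k, Integrable (fun t => (∑ l, C i l * X t l k) * D k i) μ :=
    fun i k => (integrable_finsetSum _ fun l _ => h1 i k l).mul_const _
  rw [integral_finsetSum _ fun i _ => integrable_finsetSum _ fun k _ => h2 i k]
  refine Finset.sum_congr rfl fun i _ => ?_
  rw [integral_finsetSum _ fun k _ => h2 i k]
  refine Finset.sum_congr rfl fun k _ => ?_
  rw [integral_mul_const, integral_finsetSum _ fun l _ => h1 i k l]
  simp only [integral_const_mul]

namespace LTISystem

variable {n p q : ℕ} (S : LTISystem n p q)

/-- The transient part `C (e^{tA} - J) B` of the impulse response. -/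
noncomputable def impulse (t : ℝ) : Matrix (Fin q) (Fin p) ℝ :=
  S.C * S.transient t * S.B

theorem impulse_apply (t : ℝ) (i : Fin q) (j : Fin p) :
    S.impulse t i j = ∑ l, S.B l j * ∑ k, S.C i k * S.transient t k l := by
  simp only [impulse, Matrix.mul_apply]
  exact Finset.sum_congr rfl fun l _ => mul_comm _ _

variable {S} (hS : S.IsSemistable)
include hS

theorem IsSemistable.expDecay_impulse (i : Fin q) (j : Fin p) :
    ExpDecay (fun t => S.impulse t i j) := by
  simp only [impulse_apply]
  exact ExpDecay.sum _ fun l _ =>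
    (ExpDecay.sum _ fun k _ => (hS.expDecay_transient_apply k l).const_mul _).const_mul _

/-- `(sI - A)⁻¹ = J / s + ∫₀^∞ e^{-st} (e^{tA} - J) dt` on the open right half-plane. -/
theorem IsSemistable.resolvent_eq {s : ℂ} (hs : 0 < s.re) :
    (s • (1 : Matrix (Fin n) (Fin n) ℂ) - S.A.map Complex.ofReal) *
      (s⁻¹ • S.J.map Complex.ofReal +
        Matrix.of fun i j => laplace (fun t => S.transient t i j) s) = 1 := by
  have hs0 : s ≠ 0 := fun h => by simp [h] at hs
  have hAJ : S.A.map Complex.ofReal * S.J.map Complex.ofReal = 0 := by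
    have := (Matrix.map_mul (L := S.A) (M := S.J) (f := Complex.ofRealHom)).symm
    rw [hS.A_mul_J] at this
    exact this.trans (Matrix.map_zero _ (map_zero _))
  have hL : S.A.map Complex.ofReal *
      (Matrix.of fun i j => laplace (fun t => S.transient t i j) s) =
      s • (Matrix.of fun i j => laplace (fun t => S.transient t i j) s) -
        (1 - S.J.map Complex.ofReal) := by
    ext i j
    have hA : ∀ k ∈ Finset.univ, ExpDecay (fun t => S.A i k * S.transient t k j) :=
      fun k _ => (hS.expDecay_transient_apply k j).const_mul _
    have hd := (hS.expDecay_transient_apply i j).laplace_deriv (ExpDecay.sum _ hA)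
      (fun t => hS.hasDerivAt_transient t i j) hs.le
    rw [ExpDecay.laplace_sum _ hA hs.le] at hd
    simp only [ExpDecay.laplace_const_mul] at hd
    simp only [Matrix.mul_apply, Matrix.map_apply, Matrix.of_apply, Matrix.sub_apply,
      Matrix.smul_apply, smul_eq_mul]
    rw [hd]
    congr 1
    simp [transient, Matrix.one_apply, apply_ite]
  rw [mul_add, sub_mul, sub_mul, hL, mul_smul_comm, mul_smul_comm, hAJ, smul_mul_assoc,
    smul_mul_assoc, one_mul, one_mul, smul_smul, inv_mul_cancel₀ hs0]
  simp

theorem IsSemistable.isUnit_resolvent {s : ℂ} (hs : 0 < s.re) :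
    IsUnit (s • (1 : Matrix (Fin n) (Fin n) ℂ) - S.A.map Complex.ofReal) :=
  IsUnit.of_mul_eq_one _ (hS.resolvent_eq hs)

/-- The transfer function splits into its pole `CJB / s` at the origin and the Laplace transform
of an exponentially decaying function. -/
theorem IsSemistable.transferFunction_apply {s : ℂ} (hs : 0 < s.re) (i : Fin q) (j : Fin p) :
    S.transferFunction s i j =
      s⁻¹ * (S.C * S.J * S.B) i j + laplace (fun t => S.impulse t i j) s := by
  have e : laplace (fun t => S.impulse t i j) s =
      ∑ l, S.B l j * ∑ k, S.C i k * laplace (fun t => S.transient t k l) s := by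
    simp only [impulse_apply]
    have h1 : ∀ l, ∀ k ∈ Finset.univ, ExpDecay (fun t => S.C i k * S.transient t k l) :=
      fun l k _ => (hS.expDecay_transient_apply k l).const_mul _
    rw [ExpDecay.laplace_sum _ (fun l _ => (ExpDecay.sum _ (h1 l)).const_mul _) hs.le]
    simp only [ExpDecay.laplace_const_mul, ExpDecay.laplace_sum _ (h1 _) hs.le]
  rw [transferFunction, Matrix.inv_eq_right_inv (hS.resolvent_eq hs), Matrix.mul_add,
    Matrix.add_mul, Matrix.add_apply, e]
  congr 1
  · simp only [Matrix.mul_apply, Matrix.map_apply, Matrix.smul_apply, smul_eq_mul,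
      Complex.ofReal_sum, Complex.ofReal_mul, Finset.mul_sum, Finset.sum_mul]
    exact Finset.sum_congr rfl fun _ _ => Finset.sum_congr rfl fun _ _ => by ring
  · simp only [Matrix.mul_apply, Matrix.map_apply, Matrix.of_apply]
    exact Finset.sum_congr rfl fun _ _ => mul_comm _ _

open scoped Matrix.Norms.L2Operator in
theorem IsSemistable.isHolomorphicOnRHP : IsHolomorphicOnRHP S.transferFunction := by
  intro i j s hs
  have h1 : DifferentiableAt ℂ (fun s : ℂ =>
      (s • (1 : Matrix (Fin n) (Fin n) ℂ) - S.A.map Complex.ofReal)⁻¹) s := by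
    simp only [Matrix.nonsing_inv_eq_ringInverse]
    have h2 := differentiableAt_inverse (𝕜 := ℂ) (hS.isUnit_resolvent hs)
    exact h2.comp s (f := fun s : ℂ => s • (1 : Matrix (Fin n) (Fin n) ℂ) - S.A.map Complex.ofReal)
      ((differentiableAt_id.smul_const _).sub_const _)
  have h3 : ∀ k l, DifferentiableAt ℂ (fun s : ℂ =>
      (s • (1 : Matrix (Fin n) (Fin n) ℂ) - S.A.map Complex.ofReal)⁻¹ k l) s := fun k l =>
    (LinearMap.toContinuousLinearMap (Matrix.entryLinearMap ℂ ℂ k l)).differentiableAt.comp s h1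
  refine DifferentiableAt.differentiableWithinAt ?_
  simp only [transferFunction, Matrix.mul_apply]
  exact DifferentiableAt.fun_sum fun l _ =>
    (DifferentiableAt.fun_sum fun k _ => (h3 k l).const_mul _).mul_const _

omit hS in
theorem exp_transpose_sub (t : ℝ) :
    NormedSpace.exp (t • S.Aᵀ) - S.Jᵀ = (S.transient t)ᵀ := by
  rw [← Matrix.transpose_smul, Matrix.exp_transpose, transient, Matrix.transpose_sub]

theorem IsSemistable.expDecay_transient_mul {m : ℕ} (B : Matrix (Fin n) (Fin m) ℝ) (i : Fin n)
    (j : Fin m) : ExpDecay (fun t => (S.transient t * B) i j) := by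
  simp only [Matrix.mul_apply, mul_comm _ (B _ j)]
  exact ExpDecay.sum _ fun k _ => (hS.expDecay_transient_apply i k).const_mul _

theorem IsSemistable.expDecay_mul_transient {m : ℕ} (C : Matrix (Fin m) (Fin n) ℝ) (i : Fin m)
    (j : Fin n) : ExpDecay (fun t => (C * S.transient t) i j) := by
  simp only [Matrix.mul_apply]
  exact ExpDecay.sum _ fun k _ => (hS.expDecay_transient_apply k j).const_mul _

omit hS in
theorem gramIntegrandP_eq (t : ℝ) :
    S.gramIntegrandP t = (S.transient t * S.B) * (S.transient t * S.B)ᵀ := by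
  rw [gramIntegrandP, exp_transpose_sub, Matrix.transpose_mul, ← Matrix.mul_assoc]
  rfl

omit hS in
theorem gramIntegrandQ_eq (t : ℝ) :
    S.gramIntegrandQ t = (S.C * S.transient t)ᵀ * (S.C * S.transient t) := by
  rw [gramIntegrandQ, exp_transpose_sub, Matrix.transpose_mul, Matrix.mul_assoc _ S.C]
  rfl

theorem IsSemistable.integrableOn_gramIntegrandP (i j : Fin n) :
    IntegrableOn (fun t => S.gramIntegrandP t i j) (Set.Ioi 0) := by
  simp only [gramIntegrandP_eq]
  exact (ExpDecay.matrix_mul_apply (hS.expDecay_transient_mul S.B)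
    (fun i j => hS.expDecay_transient_mul S.B j i) i j).integrableOn

theorem IsSemistable.integrableOn_gramIntegrandQ (i j : Fin n) :
    IntegrableOn (fun t => S.gramIntegrandQ t i j) (Set.Ioi 0) := by
  simp only [gramIntegrandQ_eq]
  exact (ExpDecay.matrix_mul_apply (fun i j => hS.expDecay_mul_transient S.C j i)
    (hS.expDecay_mul_transient S.C) i j).integrableOn

theorem IsSemistable.trace_gramP :
    (S.C * S.gramP * S.Cᵀ).trace = ∫ t in Set.Ioi (0 : ℝ), ∑ i, ∑ j, S.impulse t i j ^ 2 := by
  rw [gramP, trace_mul_integral_mul hS.integrableOn_gramIntegrandP]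
  congr with t
  have : S.C * S.gramIntegrandP t * S.Cᵀ = S.impulse t * (S.impulse t)ᵀ := by
    simp only [gramIntegrandP_eq, impulse, Matrix.transpose_mul, Matrix.mul_assoc]
  rw [this]
  simp [Matrix.trace, Matrix.mul_apply, sq]

theorem IsSemistable.trace_gramQ :
    (S.Bᵀ * S.gramQ * S.B).trace = ∫ t in Set.Ioi (0 : ℝ), ∑ i, ∑ j, S.impulse t i j ^ 2 := by
  rw [gramQ, trace_mul_integral_mul hS.integrableOn_gramIntegrandQ]
  congr with t
  have : S.Bᵀ * S.gramIntegrandQ t * S.B = (S.impulse t)ᵀ * S.impulse t := by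
    simp only [gramIntegrandQ_eq, impulse, Matrix.transpose_mul, Matrix.mul_assoc]
  rw [this, Finset.sum_comm]
  simp [Matrix.trace, Matrix.mul_apply, sq]

end LTISystem

/-! ### The Hardy norms of the transfer function -/

/-- Monotone convergence as `σ → 0⁺`, stated for the supremum over `σ > 0`. -/
theorem iSup_lintegral_exp_mul {W : ℝ → ℝ≥0∞} (hW : Measurable W) :
    ⨆ (σ : ℝ) (_ : 0 < σ), ∫⁻ t in Set.Ioi (0 : ℝ), ENNReal.ofReal (Real.exp (-2 * σ * t)) * W t =
      ∫⁻ t in Set.Ioi (0 : ℝ), W t := by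
  refine le_antisymm (iSup₂_le fun σ hσ => ?_) ?_
  · refine setLIntegral_mono hW fun t ht => mul_le_of_le_one_left zero_le ?_
    rw [ENNReal.ofReal_le_one, Real.exp_le_one_iff]
    have : 0 < σ * t := mul_pos hσ ht
    linarith
  · have hlim : Tendsto (fun n : ℕ => ∫⁻ t in Set.Ioi (0 : ℝ),
        ENNReal.ofReal (Real.exp (-2 * (1 / ((n : ℝ) + 1)) * t)) * W t) atTop
        (𝓝 (∫⁻ t in Set.Ioi (0 : ℝ), W t)) := by
      refine lintegral_tendsto_of_tendsto_of_monotone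
        (fun n => (Measurable.mul (by fun_prop) hW).aemeasurable) ?_ (ae_of_all _ fun t => ?_)
      · refine (ae_restrict_iff' measurableSet_Ioi).2 (ae_of_all _ fun t ht m k hmk => ?_)
        have h1 : 1 / ((k : ℝ) + 1) ≤ 1 / ((m : ℝ) + 1) := Nat.one_div_le_one_div hmk
        have h2 := mul_le_mul_of_nonneg_right h1 (le_of_lt ht)
        refine mul_le_mul_left (ENNReal.ofReal_le_ofReal (Real.exp_le_exp.2 ?_)) _
        linarith
      · have h1 : Tendsto (fun n : ℕ => Real.exp (-2 * (1 / ((n : ℝ) + 1)) * t)) atTop (𝓝 1) := by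
          have := ((tendsto_one_div_add_atTop_nhds_zero_nat (𝕜 := ℝ)).const_mul (-2)).mul_const t
          simpa [Function.comp_def] using (Real.continuous_exp.tendsto _).comp this
        have h2 := ENNReal.tendsto_ofReal h1
        rw [ENNReal.ofReal_one] at h2
        simpa using ENNReal.Tendsto.mul_const (b := W t) h2 (Or.inl one_ne_zero)
    refine le_of_tendsto' hlim fun n => ?_
    exact le_iSup₂_of_le (1 / ((n : ℝ) + 1)) (by positivity) le_rfl

theorem enorm_cexp_mul_sq (σ t x : ℝ) :
    ‖Complex.exp (-(σ : ℂ) * t) * x‖ₑ ^ 2 =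
      ENNReal.ofReal (Real.exp (-2 * σ * t)) * ENNReal.ofReal (x ^ 2) := by
  rw [← ofReal_norm, ← ENNReal.ofReal_pow (norm_nonneg _), ← ENNReal.ofReal_mul (Real.exp_nonneg _)]
  congr 1
  rw [norm_mul, mul_pow, Complex.norm_exp, Complex.norm_real, Real.norm_eq_abs, sq_abs,
    ← Real.exp_nat_mul]
  congr 2
  simp
  ring

open scoped Matrix.Norms.L2Operator in
theorem exists_norm_apply_le_spectralNorm₂ {q p : ℕ} (i : Fin q) (j : Fin p) :
    ∃ K, 0 ≤ K ∧ ∀ M : Matrix (Fin q) (Fin p) ℂ, ‖M i j‖ ≤ K * spectralNorm₂ M :=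
  ⟨_, norm_nonneg _,
    (LinearMap.toContinuousLinearMap (Matrix.entryLinearMap ℂ ℂ i j)).le_opNorm⟩

open scoped Matrix.Norms.L2Operator in
/-- A matrix with bounded entries has bounded spectral norm, as a linear map out of a
finite-dimensional space is bounded. -/
theorem exists_spectralNorm₂_le (q p : ℕ) :
    ∃ K, 0 ≤ K ∧ ∀ (M : Matrix (Fin q) (Fin p) ℂ) (b : ℝ), (∀ i j, ‖M i j‖ ≤ b) → 0 ≤ b →
      spectralNorm₂ M ≤ K * b := by
  set L := LinearMap.toContinuousLinearMap
    (Matrix.ofLinearEquiv ℂ : (Fin q → Fin p → ℂ) ≃ₗ[ℂ] Matrix (Fin q) (Fin p) ℂ).toLinearMap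
  refine ⟨‖L‖, L.opNorm_nonneg, fun M b hM hb => (L.le_opNorm fun i j => M i j).trans ?_⟩
  refine mul_le_mul_of_nonneg_left ?_ L.opNorm_nonneg
  exact (pi_norm_le_iff_of_nonneg hb).2 fun i => (pi_norm_le_iff_of_nonneg hb).2 (hM i)

namespace LTISystem

variable {n p q : ℕ} {S : LTISystem n p q} (hS : S.IsSemistable)
include hS

theorem IsSemistable.lintegral_transferFunction (h0 : S.C * S.J * S.B = 0) {σ : ℝ} (hσ : 0 < σ) :
    ENNReal.ofReal (1 / (2 * Real.pi)) *
      ∫⁻ ω : ℝ, ∑ i, ∑ j, ‖S.transferFunction ((σ : ℂ) + (ω : ℂ) * Complex.I) i j‖ₑ ^ 2 =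
    ∫⁻ t in Set.Ioi (0 : ℝ), ENNReal.ofReal (Real.exp (-2 * σ * t)) *
      ∑ i, ∑ j, ENNReal.ofReal (S.impulse t i j ^ 2) := by
  have hmem : ∀ ω : ℝ, (σ : ℂ) + (ω : ℂ) * Complex.I ∈ openRightHalfPlane := fun ω => by
    simpa [openRightHalfPlane] using hσ
  have hm : ∀ i j, Measurable fun ω : ℝ =>
      ‖S.transferFunction ((σ : ℂ) + (ω : ℂ) * Complex.I) i j‖ₑ ^ 2 := fun i j =>
    ((hS.isHolomorphicOnRHP i j).continuousOn.comp_continuous (by fun_prop)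
      hmem).measurable.enorm.pow_const 2
  have hi : ∀ i j, Measurable fun t : ℝ => ENNReal.ofReal (S.impulse t i j ^ 2) := fun i j =>
    ((hS.expDecay_impulse i j).1.measurable.pow_const 2).ennreal_ofReal
  have hei : ∀ i j, Measurable fun t : ℝ =>
      ENNReal.ofReal (Real.exp (-2 * σ * t)) * ENNReal.ofReal (S.impulse t i j ^ 2) := fun i j =>
    Measurable.mul (by fun_prop) (hi i j)
  simp only [Finset.mul_sum]
  rw [lintegral_finsetSum _ fun i _ => Finset.measurable_fun_sum _ fun j _ => hm i j,
    lintegral_finsetSum _ fun i _ => Finset.measurable_fun_sum _ fun j _ => hei i j,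
    Finset.mul_sum]
  refine Finset.sum_congr rfl fun i _ => ?_
  rw [lintegral_finsetSum _ fun j _ => hm i j, lintegral_finsetSum _ fun j _ => hei i j,
    Finset.mul_sum]
  refine Finset.sum_congr rfl fun j _ => ?_
  have hT : ∀ ω : ℝ, S.transferFunction ((σ : ℂ) + (ω : ℂ) * Complex.I) i j =
      laplace (fun t => S.impulse t i j) ((σ : ℂ) + (ω : ℂ) * Complex.I) := fun ω => by
    rw [hS.transferFunction_apply (hmem ω), h0]
    simp
  have hd := hS.expDecay_impulse i j
  have hσ' : 0 ≤ (σ : ℂ).re := hσ.le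
  simp only [hT]
  rw [lintegral_enorm_sq_laplace σ (hd.integrableOn_exp_mul hσ') (hd.memLp_exp_mul hσ'),
    ← mul_assoc, ← ENNReal.ofReal_mul (by positivity), one_div_mul_cancel Real.two_pi_pos.ne',
    ENNReal.ofReal_one, one_mul]
  simp only [enorm_cexp_mul_sq]

theorem IsSemistable.hTwoNorm_eq (h0 : S.C * S.J * S.B = 0) :
    hTwoNorm S.transferFunction =
      ENNReal.ofReal (∫ t in Set.Ioi (0 : ℝ), ∑ i, ∑ j, S.impulse t i j ^ 2) ^ (1 / 2 : ℝ) := by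
  have hi : ∀ i j, Integrable (fun t => S.impulse t i j ^ 2) (volume.restrict (Set.Ioi 0)) := by
    simp only [sq]
    exact fun i j => ((hS.expDecay_impulse i j).mul (hS.expDecay_impulse i j)).integrableOn
  have hm : ∀ i j, Measurable fun t : ℝ => ENNReal.ofReal (S.impulse t i j ^ 2) := fun i j =>
    ((hS.expDecay_impulse i j).1.measurable.pow_const 2).ennreal_ofReal
  rw [hTwoNorm]
  congr 1
  refine (iSup_congr fun σ => iSup_congr fun hσ =>
    hS.lintegral_transferFunction h0 (σ := σ) hσ).trans ?_
  rw [iSup_lintegral_exp_mul (Finset.measurable_fun_sum _ fun i _ =>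
      Finset.measurable_fun_sum _ fun j _ => hm i j),
    ofReal_integral_eq_lintegral_ofReal
      (integrable_finsetSum _ fun i _ => integrable_finsetSum _ fun j _ => hi i j)
      (ae_of_all _ fun t => Finset.sum_nonneg fun i _ => Finset.sum_nonneg fun j _ => sq_nonneg _)]
  congr with t
  refine ((ENNReal.ofReal_sum_of_nonneg fun i _ =>
    Finset.sum_nonneg fun j _ => sq_nonneg (S.impulse t i j)).trans ?_).symm
  exact Finset.sum_congr rfl fun i _ =>
    ENNReal.ofReal_sum_of_nonneg fun j _ => sq_nonneg (S.impulse t i j)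

theorem IsSemistable.hTwoNorm_toReal_sq (h0 : S.C * S.J * S.B = 0) :
    (hTwoNorm S.transferFunction).toReal ^ 2 =
      ∫ t in Set.Ioi (0 : ℝ), ∑ i, ∑ j, S.impulse t i j ^ 2 := by
  have hnn : 0 ≤ ∫ t in Set.Ioi (0 : ℝ), ∑ i, ∑ j, S.impulse t i j ^ 2 :=
    integral_nonneg fun t => Finset.sum_nonneg fun i _ => Finset.sum_nonneg fun j _ => sq_nonneg _
  rw [hS.hTwoNorm_eq h0, ← ENNReal.toReal_rpow, ENNReal.toReal_ofReal hnn, ← Real.sqrt_eq_rpow,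
    Real.sq_sqrt hnn]

/-- If an entry of the residue `CJB` at the origin is nonzero, the corresponding entry of the
transfer function is of order `1 / σ` on the segment `{σ + iω : |ω| ≤ σ}`. -/
theorem IsSemistable.eventually_le_norm_transferFunction {i : Fin q} {j : Fin p}
    (hc : (S.C * S.J * S.B) i j ≠ 0) :
    ∃ κ : ℝ, 0 < κ ∧ ∀ᶠ σ : ℝ in 𝓝[>] 0, ∀ ω : ℝ, |ω| ≤ σ →
      κ / σ ≤ ‖S.transferFunction ((σ : ℂ) + (ω : ℂ) * Complex.I) i j‖ := by
  set c := |(S.C * S.J * S.B) i j| with hcdef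
  have hc0 : 0 < c := abs_pos.2 hc
  refine ⟨c / 4, by positivity, ?_⟩
  set M := ∫ t in Set.Ioi (0 : ℝ), |S.impulse t i j|
  have hbig : ∀ᶠ σ : ℝ in 𝓝[>] 0, M ≤ c / 4 * σ⁻¹ :=
    (tendsto_inv_nhdsGT_zero.const_mul_atTop (by positivity : 0 < c / 4)).eventually_ge_atTop M
  filter_upwards [hbig, self_mem_nhdsWithin] with σ hσM hσ ω hω
  have hσ : 0 < σ := hσ
  set s : ℂ := (σ : ℂ) + (ω : ℂ) * Complex.I with hsdef
  have hs : 0 < s.re := by simpa [hsdef] using hσ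
  have hns : ‖s‖ ≤ 2 * σ := by
    refine (norm_add_le _ _).trans ?_
    rw [norm_mul, Complex.norm_I, mul_one, Complex.norm_real, Complex.norm_real, Real.norm_eq_abs,
      Real.norm_eq_abs, abs_of_pos hσ]
    linarith
  have hs0 : 0 < ‖s‖ := norm_pos_iff.2 fun h => by simp [h] at hs
  have h1 : c / (2 * σ) ≤ ‖s⁻¹ * ((S.C * S.J * S.B) i j : ℂ)‖ := by
    rw [norm_mul, norm_inv, Complex.norm_real, Real.norm_eq_abs, ← hcdef, inv_mul_eq_div]
    gcongr
  have h2 : ‖laplace (fun t => S.impulse t i j) s‖ ≤ M :=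
    (hS.expDecay_impulse i j).norm_laplace_le hs.le
  rw [hS.transferFunction_apply hs]
  have h3 := norm_sub_le_norm_add (s⁻¹ * ((S.C * S.J * S.B) i j : ℂ))
    (laplace (fun t => S.impulse t i j) s)
  have e1 : c / (2 * σ) = c / 4 / σ + c / 4 * σ⁻¹ := by field_simp; ring
  linarith

theorem IsSemistable.memHTwo_iff : MemHTwo S.transferFunction ↔ S.C * S.J * S.B = 0 := by
  refine ⟨fun h => ?_, fun h0 => ⟨hS.isHolomorphicOnRHP, ?_⟩⟩
  · ext i j
    by_contra hc
    -- On `|ω| ≤ σ` the entry is at least `κ / σ`, so the integral over the line `Re s = σ` is at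
    -- least `2κ² / σ`, which is unbounded as `σ → 0⁺`.
    obtain ⟨κ, hκ, hev⟩ := hS.eventually_le_norm_transferFunction hc
    have hfin := h.2
    rw [hTwoNorm, ENNReal.rpow_lt_top_iff_of_pos (by norm_num)] at hfin
    set X := ⨆ (σ : ℝ) (_ : 0 < σ), ENNReal.ofReal (1 / (2 * Real.pi)) *
      ∫⁻ ω : ℝ, ∑ i, ∑ j, ‖S.transferFunction ((σ : ℂ) + (ω : ℂ) * Complex.I) i j‖ₑ ^ 2 with hX
    have hbig := (tendsto_inv_nhdsGT_zero.const_mul_atTop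
      (by positivity : 0 < κ ^ 2 / Real.pi)).eventually_gt_atTop X.toReal
    obtain ⟨σ, ⟨hσe, hσb⟩, hσ⟩ := ((hev.and hbig).and self_mem_nhdsWithin).exists
    have hσ : 0 < σ := hσ
    have h1 : ENNReal.ofReal (1 / (2 * Real.pi)) *
        (ENNReal.ofReal ((κ / σ) ^ 2) * volume (Set.Icc (-σ) σ)) ≤ X := by
      refine le_trans (mul_le_mul_right ?_ _) (le_iSup₂ (f := fun (σ : ℝ) (_ : 0 < σ) =>
        ENNReal.ofReal (1 / (2 * Real.pi)) * ∫⁻ ω : ℝ, ∑ i, ∑ j,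
          ‖S.transferFunction ((σ : ℂ) + (ω : ℂ) * Complex.I) i j‖ₑ ^ 2) σ hσ)
      rw [← setLIntegral_const]
      refine (setLIntegral_mono' measurableSet_Icc fun ω hω => ?_).trans
        (setLIntegral_le_lintegral _ _)
      have h2 := hσe ω (abs_le.2 hω)
      calc ENNReal.ofReal ((κ / σ) ^ 2)
          ≤ ENNReal.ofReal (‖S.transferFunction ((σ : ℂ) + (ω : ℂ) * Complex.I) i j‖ ^ 2) :=
            ENNReal.ofReal_le_ofReal (pow_le_pow_left₀ (by positivity) h2 2)
        _ = ‖S.transferFunction ((σ : ℂ) + (ω : ℂ) * Complex.I) i j‖ₑ ^ 2 := by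
            rw [ENNReal.ofReal_pow (norm_nonneg _), ofReal_norm]
        _ ≤ ∑ j, ‖S.transferFunction ((σ : ℂ) + (ω : ℂ) * Complex.I) i j‖ₑ ^ 2 :=
            Finset.single_le_sum (f := fun j =>
              ‖S.transferFunction ((σ : ℂ) + (ω : ℂ) * Complex.I) i j‖ₑ ^ 2)
              (fun _ _ => zero_le) (Finset.mem_univ j)
        _ ≤ _ := Finset.single_le_sum (f := fun i => ∑ j,
              ‖S.transferFunction ((σ : ℂ) + (ω : ℂ) * Complex.I) i j‖ₑ ^ 2)
              (fun _ _ => zero_le) (Finset.mem_univ i)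
    rw [Real.volume_Icc, ← ENNReal.ofReal_mul (by positivity),
      ← ENNReal.ofReal_mul (by positivity), ENNReal.ofReal_le_iff_le_toReal hfin.ne] at h1
    have e : 1 / (2 * Real.pi) * ((κ / σ) ^ 2 * (σ - -σ)) = κ ^ 2 / Real.pi * σ⁻¹ := by
      have := Real.pi_ne_zero
      field_simp
      ring
    linarith
  · rw [hS.hTwoNorm_eq h0]
    exact ENNReal.rpow_lt_top_of_nonneg (by norm_num) ENNReal.ofReal_ne_top

theorem IsSemistable.memHInf_iff : MemHInf S.transferFunction ↔ S.C * S.J * S.B = 0 := by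
  refine ⟨fun h => ?_, fun h0 => ⟨hS.isHolomorphicOnRHP, ?_⟩⟩
  · ext i j
    by_contra hc
    obtain ⟨κ, hκ, hev⟩ := hS.eventually_le_norm_transferFunction hc
    obtain ⟨K, hK0, hK⟩ := exists_norm_apply_le_spectralNorm₂ i j
    have hbig := (tendsto_inv_nhdsGT_zero.const_mul_atTop hκ).eventually_gt_atTop
      (K * (hInfNorm S.transferFunction).toReal)
    obtain ⟨σ, ⟨hσe, hσb⟩, hσ⟩ := ((hev.and hbig).and self_mem_nhdsWithin).exists
    have hσ : 0 < σ := hσ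
    have h1 := hσe 0 (by simpa using hσ.le)
    have hmem : (σ : ℂ) + ((0 : ℝ) : ℂ) * Complex.I ∈ openRightHalfPlane := by
      simpa [openRightHalfPlane] using hσ
    have h2 : spectralNorm₂ (S.transferFunction ((σ : ℂ) + ((0 : ℝ) : ℂ) * Complex.I)) ≤
        (hInfNorm S.transferFunction).toReal :=
      (ENNReal.ofReal_le_iff_le_toReal h.2.ne).1 (le_iSup₂ (f := fun s (_ : s ∈ openRightHalfPlane)
        => ENNReal.ofReal (spectralNorm₂ (S.transferFunction s))) _ hmem)
    have h3 := (h1.trans (hK _)).trans (mul_le_mul_of_nonneg_left h2 hK0)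
    rw [div_eq_mul_inv] at h3
    linarith
  · obtain ⟨K, hK0, hK⟩ := exists_spectralNorm₂_le q p
    set b := ∑ i, ∑ j, ∫ t in Set.Ioi (0 : ℝ), |S.impulse t i j| with hb
    have hnn : ∀ i j, 0 ≤ ∫ t in Set.Ioi (0 : ℝ), |S.impulse t i j| :=
      fun i j => integral_nonneg fun t => abs_nonneg _
    refine lt_of_le_of_lt (iSup₂_le fun s hs => ENNReal.ofReal_le_ofReal (hK _ b (fun i j => ?_) ?_))
      ENNReal.ofReal_lt_top
    · rw [hS.transferFunction_apply hs, h0]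
      simp only [Matrix.zero_apply, Complex.ofReal_zero, mul_zero, zero_add]
      calc _ ≤ ∫ t in Set.Ioi (0 : ℝ), |S.impulse t i j| :=
            (hS.expDecay_impulse i j).norm_laplace_le (le_of_lt hs)
        _ ≤ ∑ j, ∫ t in Set.Ioi (0 : ℝ), |S.impulse t i j| :=
            Finset.single_le_sum (f := fun j => ∫ t in Set.Ioi (0 : ℝ), |S.impulse t i j|)
              (fun j _ => hnn i j) (Finset.mem_univ j)
        _ ≤ b := Finset.single_le_sum
              (f := fun i => ∑ j, ∫ t in Set.Ioi (0 : ℝ), |S.impulse t i j|)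
              (fun i _ => Finset.sum_nonneg fun j _ => hnn i j) (Finset.mem_univ i)
    · exact Finset.sum_nonneg fun i _ => Finset.sum_nonneg fun j _ => hnn i j

end LTISystem

/-! ### The linear matrix inequality -/

theorem re_map_mulVec {m n : ℕ} (M : Matrix (Fin m) (Fin n) ℝ) (x : Fin n → ℂ) :
    (fun i => ((M.map Complex.ofReal *ᵥ x) i).re) = M *ᵥ fun i => (x i).re := by
  ext i
  simp [Matrix.mulVec, dotProduct]

theorem im_map_mulVec {m n : ℕ} (M : Matrix (Fin m) (Fin n) ℝ) (x : Fin n → ℂ) :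
    (fun i => ((M.map Complex.ofReal *ᵥ x) i).im) = M *ᵥ fun i => (x i).im := by
  ext i
  simp [Matrix.mulVec, dotProduct]

theorem norm_sq_toLp_eq {m : ℕ} (x : Fin m → ℂ) :
    ‖WithLp.toLp 2 x‖ ^ 2 =
      (fun i => (x i).re) ⬝ᵥ (fun i => (x i).re) + (fun i => (x i).im) ⬝ᵥ (fun i => (x i).im) := by
  rw [EuclideanSpace.norm_sq_eq]
  simp only [dotProduct, ← Finset.sum_add_distrib, ← Complex.normSq_apply, Complex.normSq_eq_norm_sq]

namespace LTISystem

variable {n p q : ℕ} {S : LTISystem n p q}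

/-- The linear matrix inequality, tested on the vector `(x, u, w)`. -/
theorem lmi_apply {γ : ℝ} {K : Matrix (Fin n) (Fin n) ℝ} (hK : K.PosSemidef)
    (hL : (-(S.lmiMatrix γ K)).PosSemidef) (x : Fin n → ℝ) (u : Fin p → ℝ) (w : Fin q → ℝ) :
    2 * (x ⬝ᵥ K *ᵥ (S.A *ᵥ x + S.B *ᵥ u)) + 2 * (w ⬝ᵥ (S.C * (1 - S.J)) *ᵥ x) ≤
      γ * (u ⬝ᵥ u) + γ * (w ⬝ᵥ w) := by
  have h := hL.dotProduct_mulVec_nonneg (Sum.elim (Sum.elim x u) w)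
  have hKt : Kᵀ = K := by simpa using hK.isHermitian.eq
  have e1 : x ⬝ᵥ (S.Aᵀ * K) *ᵥ x = x ⬝ᵥ (K * S.A) *ᵥ x := by
    rw [Matrix.dotProduct_mulVec, dotProduct_comm, ← Matrix.mulVec_transpose,
      Matrix.transpose_mul, Matrix.transpose_transpose, hKt]
  have e2 : u ⬝ᵥ (S.Bᵀ * K) *ᵥ x = x ⬝ᵥ (K * S.B) *ᵥ u := by
    rw [Matrix.dotProduct_mulVec, dotProduct_comm, ← Matrix.mulVec_transpose,
      Matrix.transpose_mul, Matrix.transpose_transpose, hKt]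
  have e3 : x ⬝ᵥ (S.C * (1 - S.J))ᵀ *ᵥ w = w ⬝ᵥ (S.C * (1 - S.J)) *ᵥ x := by
    rw [Matrix.dotProduct_mulVec, dotProduct_comm, Matrix.vecMul_transpose]
  have e4 : (S.Bᵀ * K)ᵀ = K * S.B := by
    rw [Matrix.transpose_mul, Matrix.transpose_transpose, hKt]
  simp only [lmiMatrix, star_trivial, Matrix.neg_mulVec, dotProduct_neg, Matrix.fromBlocks_mulVec,
    sumElim_dotProduct_sumElim, Sum.elim_comp_inl, Sum.elim_comp_inr, Matrix.fromRows_mulVec,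
    Matrix.fromCols_mulVec, Matrix.smul_mulVec, Matrix.one_mulVec, Matrix.zero_mulVec,
    Matrix.add_mulVec, dotProduct_add, dotProduct_smul, smul_eq_mul, e1, e2, e3, e4, add_zero,
    dotProduct_zero] at h
  simp only [Matrix.mulVec_add, Matrix.mulVec_mulVec, dotProduct_add]
  linarith

variable (hS : S.IsSemistable)
include hS

/-- The state `x = (sI - A)⁻¹ B u` has `C J x = 0` when `C J B = 0`, since `s J x = J B u`. -/
theorem IsSemistable.mul_J_mulVec_eq_zero (h0 : S.C * S.J * S.B = 0) {s : ℂ} (hs : s ≠ 0)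
    {x : Fin n → ℂ} {u : Fin p → ℂ}
    (hx : s • x = S.A.map Complex.ofReal *ᵥ x + S.B.map Complex.ofReal *ᵥ u) :
    (S.C * S.J).map Complex.ofReal *ᵥ x = 0 := by
  have hA : (S.C * S.J).map Complex.ofReal * S.A.map Complex.ofReal = 0 := by
    refine (Matrix.map_mul (f := Complex.ofRealHom)).symm.trans ?_
    rw [Matrix.mul_assoc, hS.J_mul_A, Matrix.mul_zero]
    exact Matrix.map_zero _ (map_zero _)
  have hB : (S.C * S.J).map Complex.ofReal * S.B.map Complex.ofReal = 0 := by
    refine (Matrix.map_mul (f := Complex.ofRealHom)).symm.trans ?_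
    rw [h0]
    exact Matrix.map_zero _ (map_zero _)
  have h := congrArg ((S.C * S.J).map Complex.ofReal *ᵥ ·) hx
  simp only [Matrix.mulVec_add, Matrix.mulVec_mulVec, hA, hB, Matrix.zero_mulVec, add_zero,
    Matrix.mulVec_smul] at h
  exact (smul_eq_zero.1 h).resolve_left hs

/-- The dissipation inequality in the frequency domain: the linear matrix inequality tested on the
real and imaginary parts of `(x, u, y / γ)`, where `s x = A x + B u` and `y = C x`. -/
theorem IsSemistable.norm_output_le (h0 : S.C * S.J * S.B = 0) {γ : ℝ} (hγ : 0 < γ)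
    {K : Matrix (Fin n) (Fin n) ℝ} (hK : K.PosSemidef) (hL : (-(S.lmiMatrix γ K)).PosSemidef)
    {s : ℂ} (hs : 0 < s.re) {x : Fin n → ℂ} {u : Fin p → ℂ}
    (hx : s • x = S.A.map Complex.ofReal *ᵥ x + S.B.map Complex.ofReal *ᵥ u) :
    ‖WithLp.toLp 2 (S.C.map Complex.ofReal *ᵥ x)‖ ≤ γ * ‖WithLp.toLp 2 u‖ := by
  have hCJ := hS.mul_J_mulVec_eq_zero h0 (fun h => by simp [h] at hs) hx
  set x₁ : Fin n → ℝ := fun i => (x i).re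
  set x₂ : Fin n → ℝ := fun i => (x i).im
  set u₁ : Fin p → ℝ := fun i => (u i).re
  set u₂ : Fin p → ℝ := fun i => (u i).im
  have r1 : S.A *ᵥ x₁ + S.B *ᵥ u₁ = s.re • x₁ - s.im • x₂ := by
    rw [← re_map_mulVec, ← re_map_mulVec]
    ext i
    simpa [x₁, x₂] using (congrArg Complex.re (congrFun hx i)).symm
  have r2 : S.A *ᵥ x₂ + S.B *ᵥ u₂ = s.re • x₂ + s.im • x₁ := by
    rw [← im_map_mulVec, ← im_map_mulVec]
    ext i
    simpa [x₁, x₂] using (congrArg Complex.im (congrFun hx i)).symm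
  have c1 : (S.C * (1 - S.J)) *ᵥ x₁ = S.C *ᵥ x₁ := by
    have : (S.C * S.J) *ᵥ x₁ = 0 := by rw [← re_map_mulVec, hCJ]; rfl
    rw [Matrix.mul_sub, Matrix.mul_one, Matrix.sub_mulVec, this, sub_zero]
  have c2 : (S.C * (1 - S.J)) *ᵥ x₂ = S.C *ᵥ x₂ := by
    have : (S.C * S.J) *ᵥ x₂ = 0 := by rw [← im_map_mulVec, hCJ]; rfl
    rw [Matrix.mul_sub, Matrix.mul_one, Matrix.sub_mulVec, this, sub_zero]
  have l1 := lmi_apply hK hL x₁ u₁ (γ⁻¹ • (S.C *ᵥ x₁))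
  have l2 := lmi_apply hK hL x₂ u₂ (γ⁻¹ • (S.C *ᵥ x₂))
  have k1 : 0 ≤ x₁ ⬝ᵥ K *ᵥ x₁ := by simpa using hK.dotProduct_mulVec_nonneg x₁
  have k2 : 0 ≤ x₂ ⬝ᵥ K *ᵥ x₂ := by simpa using hK.dotProduct_mulVec_nonneg x₂
  have hKt : Kᵀ = K := by simpa using hK.isHermitian.eq
  have k3 : x₂ ⬝ᵥ K *ᵥ x₁ = x₁ ⬝ᵥ K *ᵥ x₂ := by
    rw [Matrix.dotProduct_mulVec, dotProduct_comm, ← Matrix.mulVec_transpose, hKt]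
  rw [r1, c1] at l1
  rw [r2, c2] at l2
  simp only [Matrix.mulVec_add, Matrix.mulVec_sub, Matrix.mulVec_smul, dotProduct_add,
    dotProduct_sub, dotProduct_smul, smul_dotProduct, smul_eq_mul] at l1 l2
  rw [k3] at l2
  have hy := norm_sq_toLp_eq (S.C.map Complex.ofReal *ᵥ x)
  rw [re_map_mulVec, im_map_mulVec] at hy
  have hu := norm_sq_toLp_eq u
  refine le_of_sq_le_sq ?_ (by positivity)
  rw [mul_pow, hy, hu]
  set y₁ := (S.C *ᵥ x₁) ⬝ᵥ (S.C *ᵥ x₁)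
  set y₂ := (S.C *ᵥ x₂) ⬝ᵥ (S.C *ᵥ x₂)
  have a1 := mul_nonneg hs.le k1
  have a2 := mul_nonneg hs.le k2
  have hkey : γ⁻¹ * (y₁ + y₂) ≤ γ * (u₁ ⬝ᵥ u₁ + u₂ ⬝ᵥ u₂) := by
    rw [mul_inv_cancel_left₀ hγ.ne'] at l1 l2
    linarith
  rw [inv_mul_le_iff₀ hγ] at hkey
  linarith

open scoped Matrix.Norms.L2Operator in
theorem IsSemistable.hInfNorm_le (h0 : S.C * S.J * S.B = 0) {γ : ℝ} (hγ : 0 < γ)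
    {K : Matrix (Fin n) (Fin n) ℝ} (hK : K.PosSemidef) (hL : (-(S.lmiMatrix γ K)).PosSemidef) :
    hInfNorm S.transferFunction ≤ ENNReal.ofReal γ := by
  refine iSup₂_le fun s hs => ENNReal.ofReal_le_ofReal ?_
  have hs : 0 < s.re := hs
  rw [spectralNorm₂, Matrix.l2_opNorm_def]
  refine ContinuousLinearMap.opNorm_le_bound _ hγ.le fun u => ?_
  set x : Fin n → ℂ := (s • (1 : Matrix (Fin n) (Fin n) ℂ) - S.A.map Complex.ofReal)⁻¹ *ᵥ
    (S.B.map Complex.ofReal *ᵥ u.ofLp) with hxdef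
  have hx : s • x = S.A.map Complex.ofReal *ᵥ x + S.B.map Complex.ofReal *ᵥ u.ofLp := by
    rw [← sub_eq_iff_eq_add']
    have h1 : (s • (1 : Matrix (Fin n) (Fin n) ℂ) - S.A.map Complex.ofReal) *ᵥ x =
        S.B.map Complex.ofReal *ᵥ u.ofLp := by
      rw [hxdef, Matrix.mulVec_mulVec, Matrix.mul_nonsing_inv _
        ((Matrix.isUnit_iff_isUnit_det _).1 (hS.isUnit_resolvent hs)), Matrix.one_mulVec]
    rwa [Matrix.sub_mulVec, Matrix.smul_mulVec, Matrix.one_mulVec] at h1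
  have hy : S.transferFunction s *ᵥ u.ofLp = S.C.map Complex.ofReal *ᵥ x := by
    simp only [transferFunction, hxdef, Matrix.mulVec_mulVec, Matrix.mul_assoc]
  have h := hS.norm_output_le h0 hγ hK hL hs hx
  rw [← hy] at h
  exact h

end LTISystem

theorem mainTheorem3 {n p q : ℕ} (S : LTISystem n p q) (hS : S.IsSemistable) :
    -- the objects are well defined: `J` is a limit, `sI - A` is invertible for `Re s > 0`,
    -- and the integrals that define the pseudo Gramians converge
    Tendsto (fun τ : ℝ => NormedSpace.exp (τ • S.A)) atTop (𝓝 S.J) ∧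
    (∀ s ∈ openRightHalfPlane,
      IsUnit (s • (1 : Matrix (Fin n) (Fin n) ℂ) - S.A.map Complex.ofReal)) ∧
    (∀ i j, IntegrableOn (fun τ => S.gramIntegrandP τ i j) (Set.Ioi 0)) ∧
    (∀ i j, IntegrableOn (fun τ => S.gramIntegrandQ τ i j) (Set.Ioi 0)) ∧
    -- membership in the Hardy spaces
    (MemHTwo S.transferFunction ↔ S.C * S.J * S.B = 0) ∧
    (MemHInf S.transferFunction ↔ S.C * S.J * S.B = 0) ∧
    -- the norms
    (S.C * S.J * S.B = 0 →
      (hTwoNorm S.transferFunction).toReal ^ 2 = (S.C * S.gramP * S.Cᵀ).trace ∧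
      (hTwoNorm S.transferFunction).toReal ^ 2 = (S.Bᵀ * S.gramQ * S.B).trace ∧
      ∀ γ : ℝ, 0 < γ →
        (∃ K : Matrix (Fin n) (Fin n) ℝ, K.PosSemidef ∧ (-(S.lmiMatrix γ K)).PosSemidef ∧
          S.Jᵀ * K * S.J = 0) →
        hInfNorm S.transferFunction ≤ ENNReal.ofReal γ) :=
  ⟨hS.tendsto_exp, fun _ hs => hS.isUnit_resolvent hs, hS.integrableOn_gramIntegrandP,
    hS.integrableOn_gramIntegrandQ, hS.memHTwo_iff, hS.memHInf_iff, fun h0 =>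
    ⟨(hS.hTwoNorm_toReal_sq h0).trans hS.trace_gramP.symm,
      (hS.hTwoNorm_toReal_sq h0).trans hS.trace_gramQ.symm,
      fun _ hγ ⟨_, hK, hL, _⟩ => hS.hInfNorm_le h0 hγ hK hL⟩⟩
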